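/- **Corollary 3.5.** Let $\mathcal E,\mathcal E_1,\mathcal K$ be finite-dimensional real Hilbert spaces, let $A:\mathcal E\to\mathcal E_1$ be linear and surjective, $T:\mathcal E\to\mathcal K$ linear, $f\in\mathcal E_1$, $g\in\mathcal K$, $\gamma>0$, $r>0$, $p\ge 1$. Let $v_1,\dots,v_m$ denote the coordinates of $v\in\mathcal E$ in a fixed basis, $m=\dim\mathcal E$, and put $\mathcal F(f)=\{v\in\mathcal E: Av=f\}$. Let $W_r^p(t)=\min\{|t|^p,r^p\}$ and, for $0<\varepsilon<r$, let $W_r^{p,\varepsilon}$ be the even function with $$W_r^{p,\varepsilon}(t)=\begin{cases}t^p,&0\le t\le r-\varepsilon,\\ \pi_p(t),& r-\varepsilon\le t\le r+\varepsilon,\\ r^p,& t\ge r+\varepsilon,\end{cases}$$ where $\pi_p$ is the cubic polynomial with $\pi_p(r-\varepsilon)=(r-\varepsilon)^p$, $\pi_p'(r-\varepsilon)=p(r-\varepsilon)^{p-1}$, $\pi_p(r+\varepsilon)=r^p$, $\pi_p'(r+\varepsilon)=0$; put $W_r^{p,0}=W_r^p$. Define $$\mathcal J_p(v)=\|Tv-g\|^2+\gamma\sum_{i=1}^m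 W_r^p(v_i),\qquad \mathcal J_p^\varepsilon(v)=\|Tv-g\|^2+\gamma\sum_{i=1}^m W_r^{p,\varepsilon}(v_i)\quad(0\le\varepsilon<r).$$ Then: 1. As $\varepsilon\to0$, $0\le\varepsilon<r$, the functionals $\mathcal J_p^\varepsilon$ $\Gamma$-converge to $\mathcal J_p$ on $\mathcal F(f)$. 2. There is a compact set $M\subset\mathcal E$, independent of $\varepsilon$, which for every $0\le\varepsilon<r$ contains a minimizer of $\mathcal J_p^\varepsilon$ over $\mathcal F(f)$. 3. Let $M$ be any compact set as in 2, and for every $0\le\varepsilon<r$ let $v^*_\varepsilon$ be a minimizer of $\mathcal J_p^\varepsilon$ over $M\cap\mathcal F(f)$. Then each $v^*_\varepsilon$ is a minimizer of $\mathcal J_p^\varepsilon$ over $\mathcal F(f)$, and every accumulation point of $(v^*_\varepsilon)$ as $\varepsilon\to0$ belongs to $\mathcal F(f)$ and is a minimizer of $\mathcal J_p$ over $\mathcal F(f)$. -/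

import Mathlib

open Set Filter Topology

noncomputable section

namespace TruncatedMin

/-- The truncated power potential `W_r^p(t) = min {|t|^p, r^p}`. -/
def truncPow (p r t : ℝ) : ℝ := min (|t| ^ p) (r ^ p)

/-- The coefficient `B` of the cubic below, for data `s₁ < s₂`, `γ₁, γ₂, γ₃`. -/
def cubicB (s₁ s₂ γ₁ γ₂ γ₃ : ℝ) : ℝ := γ₁ / (s₂ - s₁) - 3 * (γ₃ - γ₂) / (s₂ - s₁) ^ 2

/-- The coefficient `A` of the cubic below. -/
def cubicA (s₁ s₂ γ₁ γ₂ γ₃ : ℝ) : ℝ :=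
  γ₁ / (3 * (s₂ - s₁) ^ 2) + 2 * cubicB s₁ s₂ γ₁ γ₂ γ₃ / (3 * (s₂ - s₁))

/-- The Hermite interpolation cubic `π(t) = A (t - s₂)³ + B (t - s₂)² + C`, `C = γ₃`, with
`π(s₁) = γ₂`, `π'(s₁) = γ₁`, `π(s₂) = γ₃`, `π'(s₂) = 0`. -/
def cubic (s₁ s₂ γ₁ γ₂ γ₃ t : ℝ) : ℝ :=
  cubicA s₁ s₂ γ₁ γ₂ γ₃ * (t - s₂) ^ 3 + cubicB s₁ s₂ γ₁ γ₂ γ₃ * (t - s₂) ^ 2 + γ₃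

/-- The interpolating cubic `π_p` on `[r - ε, r + ε]`. -/
def piCubic (p r ε t : ℝ) : ℝ :=
  cubic (r - ε) (r + ε) (p * (r - ε) ^ (p - 1)) ((r - ε) ^ p) (r ^ p) t

/-- The smoothed truncated potential `W_r^{p,ε}`, an even function of `t`. For `ε = 0` the middle
branch is never reached and one gets `W_r^p` back, see `smoothTruncPow_zero`. -/
def smoothTruncPow (p r ε t : ℝ) : ℝ :=
  if |t| ≤ r - ε then |t| ^ p
  else if |t| ≤ r + ε then piCubic p r ε |t|
  else r ^ p

theorem smoothTruncPow_zero {p r : ℝ} (hp : 1 ≤ p) (hr : 0 < r) (t : ℝ) :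
    smoothTruncPow p r 0 t = truncPow p r t := by
  have hp0 : 0 ≤ p := by linarith
  unfold smoothTruncPow truncPow
  by_cases h : |t| ≤ r
  · have h2 : |t| ^ p ≤ r ^ p := Real.rpow_le_rpow (abs_nonneg t) h hp0
    simp [h, h2]
  · have h2 : r ^ p ≤ |t| ^ p := Real.rpow_le_rpow hr.le (not_le.mp h).le hp0
    simp [h, h2]

/-- The affine space `F(f) = {v : A v = f}`. -/
def feasible {E E₁ : Type*} [AddCommGroup E] [Module ℝ E] [AddCommGroup E₁] [Module ℝ E₁]
    (A : E →ₗ[ℝ] E₁) (f : E₁) : Set E := {v | A v = f}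

/-- The functional `J_p(v) = ‖T v - g‖² + γ ∑ᵢ W_r^p(vᵢ)`, where the `vᵢ` are the coordinates of
`v` in the fixed basis `b`. -/
def J {E K : Type*} [AddCommGroup E] [Module ℝ E] [NormedAddCommGroup K] [InnerProductSpace ℝ K]
    {m : ℕ} (b : Module.Basis (Fin m) ℝ E) (T : E →ₗ[ℝ] K) (g : K) (γ p r : ℝ) (v : E) : ℝ :=
  ‖T v - g‖ ^ 2 + γ * ∑ i, truncPow p r (b.repr v i)

/-- The functional `J_p^ε(v) = ‖T v - g‖² + γ ∑ᵢ W_r^{p,ε}(vᵢ)`. -/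
def Jeps {E K : Type*} [AddCommGroup E] [Module ℝ E] [NormedAddCommGroup K]
    [InnerProductSpace ℝ K] {m : ℕ} (b : Module.Basis (Fin m) ℝ E) (T : E →ₗ[ℝ] K) (g : K)
    (γ p r ε : ℝ) (v : E) : ℝ :=
  ‖T v - g‖ ^ 2 + γ * ∑ i, smoothTruncPow p r ε (b.repr v i)

/-- `Γ`-lower limit of the functions `F i : X → [-∞, ∞]` along the filter `l`, at `x`. -/
def gammaLiminf {ι X : Type*} [TopologicalSpace X] (F : ι → X → EReal) (l : Filter ι) (x : X) :
    EReal :=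
  ⨆ U ∈ 𝓝 x, liminf (fun i => ⨅ y ∈ U, F i y) l

/-- `Γ`-upper limit of the functions `F i : X → [-∞, ∞]` along the filter `l`, at `x`. -/
def gammaLimsup {ι X : Type*} [TopologicalSpace X] (F : ι → X → EReal) (l : Filter ι) (x : X) :
    EReal :=
  ⨆ U ∈ 𝓝 x, limsup (fun i => ⨅ y ∈ U, F i y) l

/-- `F i` `Γ`-converges to `G` along `l` on the topological space `X`. -/
def GammaConverges {ι X : Type*} [TopologicalSpace X] (F : ι → X → EReal) (l : Filter ι)
    (G : X → EReal) : Prop :=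
  ∀ x, gammaLiminf F l x = G x ∧ gammaLimsup F l x = G x

/-- `M` is a compact set, independent of `ε`, that contains for every `0 ≤ ε < r` some minimizer
over `S` of the functional `Φ ε`. -/
def IsCommonMinimizerSet {E : Type*} [TopologicalSpace E] (Φ : ℝ → E → ℝ) (r : ℝ) (S M : Set E) :
    Prop :=
  IsCompact M ∧ ∀ ε ∈ Ico 0 r, ∃ u ∈ M ∩ S, IsMinOn (Φ ε) S u

end TruncatedMin

end

open Set Filter Topology

namespace TruncatedMin

/-! ### Bounds and continuity of the smoothed potential. -/

section Potential

variable {p r ε : ℝ}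

/-! Two independent facts carry the result. First, on the window where the potentials differ, both
take values in `[(r - ε)^p, r^p]`; hence `J_p^ε → J_p` uniformly (`tendstoUniformly_Jeps`). As the
limit is continuous, this gives both Γ-convergence and minimality of cluster points of minimizers.

Second, the functionals need not be coercive, but a coordinate beyond `2r` already pays the maximal
price `r^p`, so it may be changed freely. Keeping `A v`, `T v` and the small coordinates, a feasible
point of bounded residual moves into a fixed ball (`exists_radius`) without raising any `J_p^ε`.
Minimizing over that ball therefore suffices, for all `ε` at once. -/

theorem mul_rpow_sub_one_le_rpow_sub_rpow (hp : 1 ≤ p) (hε : 0 ≤ ε) (hεr : ε < r) :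
    p * (r - ε) ^ (p - 1) * ε ≤ r ^ p - (r - ε) ^ p := by
  have ha : 0 < r - ε := by linarith
  have hs : 0 ≤ ε / (r - ε) := by positivity
  -- Bernoulli's inequality: the tangent to the power at `r - ε` lies below its graph at `r`.
  have h := one_add_mul_self_le_rpow_one_add (s := ε / (r - ε)) (by linarith) hp
  have h2 : r ^ p = (r - ε) ^ p * (1 + ε / (r - ε)) ^ p := by
    rw [← Real.mul_rpow ha.le (by positivity)]
    congr 1
    field_simp
    ring
  have h3 : (r - ε) ^ (p - 1) = (r - ε) ^ p / (r - ε) := Real.rpow_sub_one ha.ne' p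
  have hpos : 0 ≤ (r - ε) ^ p := by positivity
  have h4 := mul_le_mul_of_nonneg_left h hpos
  rw [← h2] at h4
  have h5 : p * (r - ε) ^ (p - 1) * ε = (r - ε) ^ p * (p * (ε / (r - ε))) := by
    rw [h3]; ring
  linarith

theorem cubic_eq_hermite {s₁ s₂ : ℝ} (γ₁ γ₂ γ₃ t : ℝ) (hs : s₁ < s₂) :
    cubic s₁ s₂ γ₁ γ₂ γ₃ t = γ₃
      - (γ₃ - γ₂) * (((s₂ - t) / (s₂ - s₁)) ^ 2 * (3 - 2 * ((s₂ - t) / (s₂ - s₁))))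
      + γ₁ * (s₂ - s₁) * (((s₂ - t) / (s₂ - s₁)) ^ 2 * (1 - (s₂ - t) / (s₂ - s₁))) := by
  have h : s₂ - s₁ ≠ 0 := by linarith
  unfold cubic cubicA cubicB
  field_simp
  ring

/-- A Hermite cubic with vanishing slope on the right and left slope at most twice the mean slope
stays between its end values. -/
theorem cubic_mem_Icc {s₁ s₂ γ₁ γ₂ γ₃ t : ℝ} (hs : s₁ < s₂) (h₀ : 0 ≤ γ₁)
    (h₁ : γ₁ * (s₂ - s₁) ≤ 2 * (γ₃ - γ₂)) (ht : t ∈ Icc s₁ s₂) :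
    cubic s₁ s₂ γ₁ γ₂ γ₃ t ∈ Icc γ₂ γ₃ := by
  rw [cubic_eq_hermite _ _ _ _ hs]
  have hpos : 0 < s₂ - s₁ := by linarith
  have hu0 : 0 ≤ (s₂ - t) / (s₂ - s₁) := div_nonneg (by linarith [ht.2]) hpos.le
  have hu1 : (s₂ - t) / (s₂ - s₁) ≤ 1 := (div_le_one hpos).2 (by linarith [ht.1])
  generalize (s₂ - t) / (s₂ - s₁) = u at hu0 hu1
  have hslope : 0 ≤ γ₁ * (s₂ - s₁) := by positivity
  generalize γ₁ * (s₂ - s₁) = c at h₁ hslope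
  have hw : 0 ≤ u ^ 2 * (1 - u) := mul_nonneg (sq_nonneg u) (by linarith)
  have hD : 0 ≤ γ₃ - γ₂ := by linarith
  constructor
  · have h : 0 ≤ 1 - u ^ 2 * (3 - 2 * u) := by
      have : 1 - u ^ 2 * (3 - 2 * u) = (1 - u) ^ 2 * (1 + 2 * u) := by ring
      rw [this]; positivity
    nlinarith [mul_nonneg hD h, mul_nonneg hslope hw]
  -- With `D = γ₃ - γ₂`, the gap to `γ₃` is at least `D u²(3 - 2u) - 2D u²(1 - u) = D u²`.
  · nlinarith [mul_le_mul_of_nonneg_right h₁ hw, mul_nonneg hD (sq_nonneg u)]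

/-- The window has length `2ε`, so the tangent inequality over length `ε` is exactly the slope
condition with factor two. -/
theorem piCubic_mem_Icc (hp : 1 ≤ p) (hε : 0 < ε) (hεr : ε < r) {t : ℝ}
    (ht : t ∈ Icc (r - ε) (r + ε)) : piCubic p r ε t ∈ Icc ((r - ε) ^ p) (r ^ p) := by
  have ha : 0 < r - ε := by linarith
  refine cubic_mem_Icc (by linarith) (by positivity) ?_ ht
  have := mul_rpow_sub_one_le_rpow_sub_rpow hp hε.le hεr
  linarith

theorem smoothTruncPow_mem_Icc (hp : 1 ≤ p) (hε : 0 ≤ ε) (hεr : ε < r) {t : ℝ}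
    (ht : r - ε < |t|) : smoothTruncPow p r ε t ∈ Icc ((r - ε) ^ p) (r ^ p) := by
  have hle : (r - ε) ^ p ≤ r ^ p :=
    Real.rpow_le_rpow (by linarith) (by linarith) (by linarith)
  unfold smoothTruncPow
  rw [if_neg ht.not_ge]
  split_ifs with h
  · exact piCubic_mem_Icc hp (by linarith) hεr ⟨ht.le, h⟩
  · exact ⟨hle, le_rfl⟩

theorem smoothTruncPow_nonneg (hp : 1 ≤ p) (hε : 0 ≤ ε) (hεr : ε < r) (t : ℝ) :
    0 ≤ smoothTruncPow p r ε t := by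
  by_cases h : |t| ≤ r - ε
  · rw [smoothTruncPow, if_pos h]
    positivity
  · exact (Real.rpow_nonneg (by linarith) p).trans
      (smoothTruncPow_mem_Icc hp hε hεr (not_le.1 h)).1

theorem smoothTruncPow_le (hp : 1 ≤ p) (hε : 0 ≤ ε) (hεr : ε < r) (t : ℝ) :
    smoothTruncPow p r ε t ≤ r ^ p := by
  by_cases h : |t| ≤ r - ε
  · rw [smoothTruncPow, if_pos h]
    exact Real.rpow_le_rpow (abs_nonneg t) (by linarith) (by linarith)
  · exact (smoothTruncPow_mem_Icc hp hε hεr (not_le.1 h)).2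

theorem smoothTruncPow_of_lt_abs (hε : 0 ≤ ε) {t : ℝ} (ht : r + ε < |t|) :
    smoothTruncPow p r ε t = r ^ p := by
  rw [smoothTruncPow, if_neg (by linarith), if_neg (by linarith)]

theorem abs_smoothTruncPow_sub_truncPow_le (hp : 1 ≤ p) (hε : 0 ≤ ε) (hεr : ε < r) (t : ℝ) :
    |smoothTruncPow p r ε t - truncPow p r t| ≤ r ^ p - (r - ε) ^ p := by
  have hp0 : 0 ≤ p := by linarith
  have hle : (r - ε) ^ p ≤ r ^ p := Real.rpow_le_rpow (by linarith) (by linarith) hp0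
  by_cases h : |t| ≤ r - ε
  · have h2 : |t| ^ p ≤ r ^ p := Real.rpow_le_rpow (abs_nonneg t) (by linarith) hp0
    rw [smoothTruncPow, if_pos h, truncPow, min_eq_left h2, sub_self, abs_zero]
    linarith
  · obtain ⟨h1, h2⟩ := smoothTruncPow_mem_Icc hp hε hεr (not_le.1 h)
    have h3 : (r - ε) ^ p ≤ truncPow p r t :=
      le_min (Real.rpow_le_rpow (by linarith) (not_le.1 h).le hp0) hle
    have h4 : truncPow p r t ≤ r ^ p := min_le_right _ _
    rw [abs_le]
    constructor <;> linarith

theorem continuous_truncPow (hp : 1 ≤ p) : Continuous (truncPow p r) :=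
  (continuous_abs.rpow_const fun _ => Or.inr (by linarith)).min continuous_const

theorem continuous_smoothTruncPow (hp : 1 ≤ p) (hε : 0 ≤ ε) (hεr : ε < r) :
    Continuous (smoothTruncPow p r ε) := by
  rcases hε.eq_or_lt with rfl | hε'
  · rw [funext (smoothTruncPow_zero hp hεr)]
    exact continuous_truncPow hp
  · have hs : r - ε < r + ε := by linarith
    have hπ : Continuous (piCubic p r ε) := by
      unfold piCubic cubic
      fun_prop
    refine Continuous.if_le (continuous_abs.rpow_const fun _ => Or.inr (by linarith))
      (Continuous.if_le (hπ.comp continuous_abs) continuous_const continuous_abs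
        continuous_const ?_) continuous_abs continuous_const ?_
    · intro t ht
      simp only [ht, piCubic]
      rw [cubic_eq_hermite _ _ _ _ hs]
      simp
    · intro t ht
      have h : r + ε - (r - ε) ≠ 0 := by linarith
      rw [ht, if_pos hs.le, piCubic, cubic_eq_hermite _ _ _ _ hs, div_self h]
      ring

end Potential

/-! ### Uniform convergence and continuity of the functionals. -/

section Functional

variable {E K : Type*} [NormedAddCommGroup E] [InnerProductSpace ℝ E]
  [NormedAddCommGroup K] [InnerProductSpace ℝ K]
  {m : ℕ} (b : Module.Basis (Fin m) ℝ E) (T : E →ₗ[ℝ] K) (g : K) {γ p r ε : ℝ}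

theorem abs_Jeps_sub_J_le (hγ : 0 < γ) (hp : 1 ≤ p) (hε : 0 ≤ ε) (hεr : ε < r) (v : E) :
    |Jeps b T g γ p r ε v - J b T g γ p r v| ≤ γ * (m * (r ^ p - (r - ε) ^ p)) := by
  have h : Jeps b T g γ p r ε v - J b T g γ p r v =
      γ * ∑ i, (smoothTruncPow p r ε (b.repr v i) - truncPow p r (b.repr v i)) := by
    rw [Finset.sum_sub_distrib, Jeps, J]
    ring
  rw [h, abs_mul, abs_of_pos hγ]
  gcongr
  calc |∑ i, (smoothTruncPow p r ε (b.repr v i) - truncPow p r (b.repr v i))|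
      ≤ ∑ i, |smoothTruncPow p r ε (b.repr v i) - truncPow p r (b.repr v i)| :=
        Finset.abs_sum_le_sum_abs _ _
    _ ≤ ∑ _i : Fin m, (r ^ p - (r - ε) ^ p) :=
        Finset.sum_le_sum fun i _ => abs_smoothTruncPow_sub_truncPow_le hp hε hεr _
    _ = m * (r ^ p - (r - ε) ^ p) := by
        rw [Finset.sum_const, Finset.card_univ, Fintype.card_fin, nsmul_eq_mul]

/-- The functionals `J_p^ε` converge to `J_p` uniformly as `ε → 0`. -/
theorem tendstoUniformly_Jeps (hγ : 0 < γ) (hp : 1 ≤ p) :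
    TendstoUniformly (Jeps b T g γ p r) (J b T g γ p r) (𝓝[Ico 0 r] 0) := by
  rw [Metric.tendstoUniformly_iff]
  intro η hη
  have hc : ContinuousAt (fun ε : ℝ => γ * (m * (r ^ p - (r - ε) ^ p))) 0 := by
    have h : ContinuousAt (fun ε : ℝ => (r - ε) ^ p) 0 :=
      (by fun_prop : ContinuousAt (fun ε : ℝ => r - ε) 0).rpow_const (Or.inr (by linarith))
    fun_prop
  have hlim : Tendsto (fun ε : ℝ => γ * (m * (r ^ p - (r - ε) ^ p))) (𝓝[Ico 0 r] 0) (𝓝 0) := by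
    simpa using hc.tendsto.mono_left (nhdsWithin_le_nhds (s := Ico 0 r))
  filter_upwards [hlim.eventually_lt_const hη, self_mem_nhdsWithin] with ε h hε v
  rw [dist_comm, Real.dist_eq]
  exact (abs_Jeps_sub_J_le b T g hγ hp hε.1 hε.2 v).trans_lt h

variable [FiniteDimensional ℝ E]

theorem continuous_coord (i : Fin m) : Continuous fun v : E => b.repr v i :=
  (b.coord i).continuous_of_finiteDimensional

theorem continuous_Jeps (hp : 1 ≤ p) (hε : 0 ≤ ε) (hεr : ε < r) :
    Continuous (Jeps b T g γ p r ε) := by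
  have hT : Continuous T := T.continuous_of_finiteDimensional
  have hW (i : Fin m) : Continuous fun v : E => smoothTruncPow p r ε (b.repr v i) :=
    (continuous_smoothTruncPow hp hε hεr).comp (continuous_coord b i)
  unfold Jeps
  fun_prop

theorem continuous_J (hp : 1 ≤ p) : Continuous (J b T g γ p r) := by
  have hT : Continuous T := T.continuous_of_finiteDimensional
  have hW (i : Fin m) : Continuous fun v : E => truncPow p r (b.repr v i) :=
    (continuous_truncPow hp).comp (continuous_coord b i)
  unfold J
  fun_prop

end Functional

/-- Uniform convergence to a continuous limit implies `Γ`-convergence. -/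
theorem gammaConverges_of_tendstoUniformly {ι X : Type*} [TopologicalSpace X] {l : Filter ι}
    [l.NeBot] {F : ι → X → ℝ} {G : X → ℝ} (h : TendstoUniformly F G l) (hG : Continuous G) :
    GammaConverges (fun i x => (F i x : EReal)) l (fun x => (G x : EReal)) := by
  intro x
  have hle : gammaLiminf (fun i x => (F i x : EReal)) l x ≤
      gammaLimsup (fun i x => (F i x : EReal)) l x :=
    iSup₂_mono fun U _ => liminf_le_limsup
  have hup : gammaLimsup (fun i x => (F i x : EReal)) l x ≤ G x := by
    -- The constant recovery sequence `x` suffices.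
    refine iSup₂_le fun U hU => ?_
    have hx : Tendsto (fun i => (F i x : EReal)) l (𝓝 (G x : EReal)) :=
      (continuous_coe_real_ereal.tendsto _).comp (h.tendsto_at x)
    rw [← hx.limsup_eq]
    exact limsup_le_limsup (Eventually.of_forall fun i => iInf₂_le x (mem_of_mem_nhds hU))
  have hlow : (G x : EReal) ≤ gammaLiminf (fun i x => (F i x : EReal)) l x := by
    refine EReal.ge_of_forall_gt_iff_ge.1 fun a ha => ?_
    have ha' : a < G x := EReal.coe_lt_coe_iff.1 ha
    obtain ⟨c, hac, hcx⟩ := exists_between ha'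
    -- On this neighbourhood a uniform error below `c - a` keeps `F i` above `a`.
    have hU : {y | c < G y} ∈ 𝓝 x := (isOpen_lt continuous_const hG).mem_nhds hcx
    refine le_trans ?_ (le_iSup₂ (f := fun U (_ : U ∈ 𝓝 x) =>
      liminf (fun i => ⨅ y ∈ U, (F i y : EReal)) l) _ hU)
    refine le_liminf_of_le (by isBoundedDefault) ?_
    filter_upwards [Metric.tendstoUniformly_iff.1 h (c - a) (by linarith)] with i hi
    refine le_iInf₂ fun y hy => EReal.coe_le_coe_iff.2 ?_
    have h1 := (abs_lt.1 (Real.dist_eq _ _ ▸ hi y)).2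
    have h2 : c < G y := hy
    linarith
  exact ⟨le_antisymm (hle.trans hup) hlow, le_antisymm hup (hlow.trans hle)⟩

/-- Cluster points of minimizers of uniformly convergent functions minimize a continuous limit. -/
theorem isMinOn_of_mapClusterPt {ι X : Type*} [TopologicalSpace X] {l : Filter ι}
    {F : ι → X → ℝ} {G : X → ℝ} (h : TendstoUniformly F G l) (hG : Continuous G) {S : Set X}
    {v : ι → X} (hv : ∀ᶠ i in l, IsMinOn (F i) S (v i)) {x : X} (hx : MapClusterPt x l v) :
    IsMinOn G S x := by
  refine isMinOn_iff.2 fun y hy => le_of_forall_pos_le_add fun η hη => ?_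
  have hev : ∀ᶠ i in l, G (v i) ≤ G y + η := by
    filter_upwards [Metric.tendstoUniformly_iff.1 h (η / 2) (by linarith), hv] with i hi hmin
    have h1 := (abs_lt.1 (Real.dist_eq _ _ ▸ hi (v i))).2
    have h2 := (abs_lt.1 (Real.dist_eq _ _ ▸ hi y)).1
    have h3 := isMinOn_iff.1 hmin y hy
    linarith
  exact (isClosed_le hG continuous_const).mem_of_mapClusterPt hx hev

/-- The open mapping theorem applied to `S` onto its range, which is finite-dimensional and hence
complete. -/
theorem exists_bound_preimage {V W : Type*} [NormedAddCommGroup V] [NormedSpace ℝ V]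
    [FiniteDimensional ℝ V] [NormedAddCommGroup W] [NormedSpace ℝ W]
    (S : V →ₗ[ℝ] W) : ∃ C > 0, ∀ v, ∃ w, S w = S v ∧ ‖w‖ ≤ C * ‖S v‖ := by
  have := FiniteDimensional.complete ℝ V
  have := FiniteDimensional.complete ℝ S.range
  obtain ⟨C, hC, h⟩ := S.rangeRestrict.toContinuousLinearMap.exists_preimage_norm_le
    S.surjective_rangeRestrict
  refine ⟨C, hC, fun v => ?_⟩
  obtain ⟨w, hw, hn⟩ := h (S.rangeRestrict v)
  exact ⟨w, congrArg Subtype.val hw, hn⟩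

/-! ### A compact set of minimizers common to all `ε`. -/

section Existence

variable {E E₁ K : Type*}
  [NormedAddCommGroup E] [InnerProductSpace ℝ E]
  [NormedAddCommGroup E₁] [InnerProductSpace ℝ E₁]
  [NormedAddCommGroup K] [InnerProductSpace ℝ K]
  {m : ℕ} (b : Module.Basis (Fin m) ℝ E) (A : E →ₗ[ℝ] E₁) (T : E →ₗ[ℝ] K) (f : E₁) (g : K)
  {γ p r : ℝ}

/-- The coordinates of `v` outside `I`, together with `A v` and `T v`. -/
noncomputable def partialData (I : Finset (Fin m)) : E →ₗ[ℝ] E₁ × K × (Fin m → ℝ) :=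
  A.prod (T.prod (LinearMap.pi fun i => if i ∈ I then 0 else b.coord i))

theorem partialData_apply (I : Finset (Fin m)) (v : E) :
    partialData b A T I v = (A v, T v, fun i => if i ∈ I then 0 else b.repr v i) := by
  refine Prod.ext rfl (Prod.ext rfl (funext fun i => ?_))
  change (if i ∈ I then (0 : E →ₗ[ℝ] ℝ) else b.coord i) v = if i ∈ I then 0 else b.repr v i
  split_ifs <;> rfl

variable [FiniteDimensional ℝ E]

theorem feasible_isClosed : IsClosed (feasible A f) :=
  isClosed_eq A.continuous_of_finiteDimensional continuous_const

/-- Feasible points with bounded residual can be moved into a ball of fixed radius while keeping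
`A v`, `T v` and every coordinate of modulus at most `ρ`. -/
theorem exists_radius (ρ c : ℝ) :
    ∃ R, ∀ v ∈ feasible A f, ‖T v - g‖ ≤ c → ∃ w ∈ feasible A f, ‖w‖ ≤ R ∧ T w = T v ∧
      ∀ i, |b.repr v i| ≤ ρ → b.repr w i = b.repr v i := by
  choose C hC h using fun I : Finset (Fin m) => exists_bound_preimage (partialData b A T I)
  set D := max ‖f‖ (max (c + ‖g‖) ρ) with hD
  have hD0 : 0 ≤ D := (norm_nonneg f).trans (le_max_left _ _)
  -- The index set of large coordinates varies with `v`, but only finitely many sets occur; the sum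
  -- dominates each constant.
  refine ⟨(∑ I, C I) * D, fun v hv hTv => ?_⟩
  set I := Finset.univ.filter fun i => ρ < |b.repr v i| with hI
  obtain ⟨w, hw, hn⟩ := h I v
  have hbound : ‖partialData b A T I v‖ ≤ D := by
    rw [partialData_apply]
    refine norm_prod_le_iff.2 ⟨?_, norm_prod_le_iff.2 ⟨?_, ?_⟩⟩
    · exact (congrArg norm (show A v = f from hv)).le.trans (le_max_left _ _)
    · have := norm_le_norm_sub_add (T v) g
      exact le_trans (by linarith) ((le_max_left _ _).trans (le_max_right _ _))
    · refine (pi_norm_le_iff_of_nonneg hD0).2 fun i => ?_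
      by_cases hi : i ∈ I
      · simpa [hi] using hD0
      · have hi' : |b.repr v i| ≤ ρ := by simpa [hI] using hi
        simp only [if_neg hi]
        exact hi'.trans ((le_max_right _ _).trans (le_max_right _ _))
  rw [partialData_apply, partialData_apply] at hw
  simp only [Prod.mk.injEq] at hw
  refine ⟨w, hw.1.trans hv, hn.trans ?_, hw.2.1, fun i hi => ?_⟩
  · exact mul_le_mul (Finset.single_le_sum (fun J _ => (hC J).le) (Finset.mem_univ I)) hbound
      (norm_nonneg _) (Finset.sum_nonneg fun J _ => (hC J).le)
  · have hi' : i ∉ I := by simpa [hI] using hi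
    simpa [hi'] using congrFun hw.2.2 i

theorem exists_isCommonMinimizerSet (hA : Function.Surjective A) (hγ : 0 < γ) (hp : 1 ≤ p)
    (hr : 0 < r) : ∃ M, IsCommonMinimizerSet (Jeps b T g γ p r) r (feasible A f) M := by
  obtain ⟨v₀, hv₀⟩ := hA f
  -- An upper bound for `J_p^ε(v₀)` valid for every `ε`. The threshold `2r` below exceeds every `r +
  -- ε`.
  set B := ‖T v₀ - g‖ ^ 2 + γ * (m * r ^ p) with hB
  obtain ⟨R, hR⟩ := exists_radius b A T f g (2 * r) (√B)
  have := FiniteDimensional.proper_real E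
  have hmod : ∀ ε ∈ Ico 0 r, ∀ v ∈ feasible A f, ‖T v - g‖ ≤ √B →
      ∃ w ∈ Metric.closedBall 0 R ∩ feasible A f,
        Jeps b T g γ p r ε w ≤ Jeps b T g γ p r ε v := by
    intro ε hε v hv hTv
    obtain ⟨w, hw, hwR, hTw, hcoord⟩ := hR v hv hTv
    refine ⟨w, ⟨mem_closedBall_zero_iff.2 hwR, hw⟩, ?_⟩
    unfold Jeps
    rw [hTw]
    gcongr with i
    by_cases hi : |b.repr v i| ≤ 2 * r
    · rw [hcoord i hi]
    · rw [smoothTruncPow_of_lt_abs hε.1 (t := b.repr v i) (by linarith [hε.2])]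
      exact smoothTruncPow_le hp hε.1 hε.2 _
  have hv₀le : ‖T v₀ - g‖ ≤ √B := Real.le_sqrt_of_sq_le (by rw [hB]; simp; positivity)
  refine ⟨Metric.closedBall 0 R, isCompact_closedBall 0 R, fun ε hε => ?_⟩
  obtain ⟨w₀, hw₀, hw₀le⟩ := hmod ε hε v₀ hv₀ hv₀le
  obtain ⟨u, hu, hmin⟩ := ((isCompact_closedBall 0 R).inter_right
    (feasible_isClosed A f)).exists_isMinOn ⟨w₀, hw₀⟩
    (continuous_Jeps b T g (γ := γ) hp hε.1 hε.2).continuousOn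
  refine ⟨u, hu, isMinOn_iff.2 fun v hv => ?_⟩
  -- A point with larger residual already loses to `v₀`, since the potential is nonnegative.
  by_cases hTv : ‖T v - g‖ ≤ √B
  · obtain ⟨w, hw, hwle⟩ := hmod ε hε v hv hTv
    exact (isMinOn_iff.1 hmin w hw).trans hwle
  · have h1 : B < ‖T v - g‖ ^ 2 := Real.lt_sq_of_sqrt_lt (not_le.1 hTv)
    have h2 : Jeps b T g γ p r ε v₀ ≤ B := by
      rw [hB, Jeps]
      gcongr
      calc ∑ i, smoothTruncPow p r ε (b.repr v₀ i) ≤ ∑ _i : Fin m, r ^ p :=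
            Finset.sum_le_sum fun i _ => smoothTruncPow_le hp hε.1 hε.2 _
        _ = m * r ^ p := by simp
    have h3 : ‖T v - g‖ ^ 2 ≤ Jeps b T g γ p r ε v :=
      le_add_of_nonneg_right (mul_nonneg hγ.le
        (Finset.sum_nonneg fun i _ => smoothTruncPow_nonneg hp hε.1 hε.2 _))
    exact (isMinOn_iff.1 hmin w₀ hw₀).trans (by linarith)

end Existence

end TruncatedMin

theorem corollary3p5
    {E E₁ K : Type*}
    [NormedAddCommGroup E] [InnerProductSpace ℝ E] [FiniteDimensional ℝ E]
    [NormedAddCommGroup E₁] [InnerProductSpace ℝ E₁] [FiniteDimensional ℝ E₁]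
    [NormedAddCommGroup K] [InnerProductSpace ℝ K] [FiniteDimensional ℝ K]
    {m : ℕ} (b : Module.Basis (Fin m) ℝ E)
    (A : E →ₗ[ℝ] E₁) (hA : Function.Surjective A) (f : E₁)
    (T : E →ₗ[ℝ] K) (g : K)
    (γ p r : ℝ) (hγ : 0 < γ) (hp : 1 ≤ p) (hr : 0 < r) :
    -- Gamma-convergence on the affine space, as `ε → 0` in `[0, r)`
    TruncatedMin.GammaConverges
      (fun (ε : ℝ) (v : TruncatedMin.feasible A f) =>
        ((TruncatedMin.Jeps b T g γ p r ε v : ℝ) : EReal))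
      (𝓝[Ico 0 r] 0)
      (fun v : TruncatedMin.feasible A f => ((TruncatedMin.J b T g γ p r v : ℝ) : EReal)) ∧
    -- there is a compact set, independent of `ε`, with a constrained minimizer for each `ε`
    (∃ M : Set E, TruncatedMin.IsCommonMinimizerSet
      (TruncatedMin.Jeps b T g γ p r) r (TruncatedMin.feasible A f) M) ∧
    -- for every such set, minimizers in it are minimizers on the whole affine space, and the
    -- accumulation points as `ε → 0` are minimizers of the limit functional
    (∀ M : Set E, TruncatedMin.IsCommonMinimizerSet
        (TruncatedMin.Jeps b T g γ p r) r (TruncatedMin.feasible A f) M →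
      ∀ v : ℝ → E,
        (∀ ε ∈ Ico 0 r, v ε ∈ M ∩ TruncatedMin.feasible A f ∧
          IsMinOn (TruncatedMin.Jeps b T g γ p r ε) (M ∩ TruncatedMin.feasible A f) (v ε)) →
        (∀ ε ∈ Ico 0 r,
          IsMinOn (TruncatedMin.Jeps b T g γ p r ε) (TruncatedMin.feasible A f) (v ε)) ∧
        ∀ x : E, MapClusterPt x (𝓝[Ico 0 r] 0) v →
          x ∈ TruncatedMin.feasible A f ∧
            IsMinOn (TruncatedMin.J b T g γ p r) (TruncatedMin.feasible A f) x) := by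
  have hunif := TruncatedMin.tendstoUniformly_Jeps b T g (r := r) hγ hp
  have hcont := TruncatedMin.continuous_J b T g (γ := γ) (r := r) hp
  have : (𝓝[Ico 0 r] (0 : ℝ)).NeBot :=
    mem_closure_iff_nhdsWithin_neBot.1 (subset_closure ⟨le_rfl, hr⟩)
  refine ⟨TruncatedMin.gammaConverges_of_tendstoUniformly (hunif.comp Subtype.val)
    (hcont.comp continuous_subtype_val),
    TruncatedMin.exists_isCommonMinimizerSet b A T f g hA hγ hp hr, fun M hM v hv => ?_⟩
  have hglobal : ∀ ε ∈ Ico 0 r,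
      IsMinOn (TruncatedMin.Jeps b T g γ p r ε) (TruncatedMin.feasible A f) (v ε) := by
    intro ε hε
    obtain ⟨u, hu, hmin⟩ := hM.2 ε hε
    -- `M` contains a global minimizer `u`, so the minimum over `M` is the global one.
    exact isMinOn_iff.2 fun y hy =>
      (isMinOn_iff.1 (hv ε hε).2 u hu).trans (isMinOn_iff.1 hmin y hy)
  refine ⟨hglobal, fun x hx => ⟨?_, ?_⟩⟩
  · refine (TruncatedMin.feasible_isClosed A f).mem_of_mapClusterPt hx ?_
    filter_upwards [self_mem_nhdsWithin] with ε hε using (hv ε hε).1.2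
  · refine TruncatedMin.isMinOn_of_mapClusterPt hunif hcont ?_ hx
    filter_upwards [self_mem_nhdsWithin] with ε hε using hglobal ε hε
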